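/- Let $n\in\{2,3\}$, let $\Omega\subset\mathbb R^n$ be a nonempty bounded convex open set, $y_d\in L^2(\Omega)$, $a,b\in\mathbb R$ and $\alpha>0$. Write $(\cdot,\cdot)$ for the inner product of $L^2(\Omega)$ (also of vector fields). For $u\in L^2(\Omega)$ let $Su\in H^1_0(\Omega)$ be the weak solution of $-\Delta y=u$ in $\Omega$, $y=0$ on $\partial\Omega$. Assume the Slater condition: there is $\hat u\in L^2(\Omega)$ such that $S\hat u$ has a representative continuous on $\overline\Omega$ with $a<(S\hat u)(x)<b$ for all $x\in\overline\Omega$. For $\lambda>0$ let $(\mathrm P_\lambda)$ be the problem of minimizing $\frac12\|y-y_d\|^2_{L^2(\Omega)}+\frac\alpha2\|u\|^2_{L^2(\Omega)}$ over $u\in L^2(\Omega)$, $y=Su$ with $a\le\lambda u+y\le b$ a.e. in $\Omega$. Lagrange multipliers of $(\mathrm P_\lambda)$ at a solution $(y,u)$ are functions $\mu_a,\mu_b\in L^2(\Omega)$, nonnegative a.e., for which there is $p\in H_0^1(\Omega)$ (the adjoint state) with $$(\nabla p,\nabla z)=(y-y_d-\mu_a+\mu_b,z)\quad\forall z\in H^1_0(\Omega),\qquad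 \alpha u+p+\lambda\mu_b-\lambda\mu_a=0\ \text{ a.e. in }\Omega,$$ $$(\mu_a,a-\lambda u-y)=(\mu_b,\lambda u+y-b)=0.$$ Let $\mathcal T$ be a finite face-to-face partition, into closed $n$-simplices, of a set $\overline\Omega_h\subseteq\overline\Omega$ with interior $\Omega_h$; let $Z_h$ be the space of functions that are continuous on $\overline\Omega$, affine on each simplex, and zero on $\overline\Omega\setminus\Omega_h$. Let $(\mathrm P_{\lambda,h})$ be the problem of minimizing $\frac12\|y_h-y_d\|^2_{L^2(\Omega_h)}+\frac\alpha2\|u_h\|^2_{L^2(\Omega_h)}$ over $y_h,u_h\in Z_h$ with $(\nabla y_h,\nabla z_h)=(u_h,z_h)$ for all $z_h\in Z_h$ and $a\le\lambda u_h+y_h\le b$ a.e. in $\Omega$. Lagrange multipliers of $(\mathrm P_{\lambda,h})$ at a solution $(y_h,u_h)$ are functions $\mu_{a,h},\mu_{b,h}\in L^2(\Omega)$ satisfying, with some adjoint state $p_h\in Z_h$, the conditions above with $y,u,p,\mu_a,\mu_b$ replaced by $y_h,u_h,p_h,\mu_{a,h},\mu_{b,h}$ and $z\in H^1_0(\Omega)$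 replaced by $z_h\in Z_h$. Nodal Lagrange multipliers of $(\mathrm P_{\lambda,h})$ at $(y_h,u_h)$ are vectors $m_a,m_b\ge0$, indexed by the vertices $x_i$ of $\mathcal T$ in $\Omega_h$, such that for some $p_h\in Z_h$ and all $z_h\in Z_h$ $$(\nabla p_h,\nabla z_h)=(y_h-y_d,z_h)+\sum_i(m_{b,i}-m_{a,i})z_h(x_i),\qquad \alpha(u_h,z_h)+(p_h,z_h)+\lambda\sum_i(m_{b,i}-m_{a,i})z_h(x_i)=0,$$ $$\sum_i m_{a,i}\,(a-\lambda u_h-y_h)(x_i)=\sum_i m_{b,i}\,(\lambda u_h+y_h-b)(x_i)=0.$$ Then there is a constant $C$, depending only on $n,\Omega,y_d,a,b,\alpha$ and not on $\lambda$ or $\mathcal T$ (hence not on the mesh size $h$), such that for every $\lambda>0$ (in particular along every sequence $\lambda_k\to0$ of positive numbers): 1. all Lagrange multipliers of $(\mathrm P_\lambda)$ satisfy $\|\mu_a\|_{L^1(\Omega)}\le C$ and $\|\mu_b\|_{L^1(\Omega)}\le C$; 2. for every $\mathcal T$, all Lagrange multipliers of $(\mathrm P_{\lambda,h})$ satisfy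 $\|\mu_{a,h}\|_{L^1(\Omega)}\le C$ and $\|\mu_{b,h}\|_{L^1(\Omega)}\le C$; 3. for every $\mathcal T$, all nodal Lagrange multipliers of $(\mathrm P_{\lambda,h})$ satisfy $\sum_i m_{a,i}\le C$ and $\sum_i m_{b,i}\le C$. -/

import Mathlib

open MeasureTheory Filter Topology
open scoped ContDiff

noncomputable section

namespace Lavrentiev

/-- `ℝⁿ` with the Euclidean norm. -/
abbrev Pt (n : ℕ) : Type := EuclideanSpace ℝ (Fin n)

variable {n : ℕ}

/-- Real functions in `L²(Ω)` (as representatives). -/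
def MemL2 (Ω : Set (Pt n)) (f : Pt n → ℝ) : Prop :=
  MemLp f 2 (volume.restrict Ω)

/-- The inner product `(f, g)` of `L²(Ω)`. -/
def ip (Ω : Set (Pt n)) (f g : Pt n → ℝ) : ℝ := ∫ x in Ω, f x * g x

/-- The inner product `∫_Ω F · G` of two vector fields. -/
def vip (Ω : Set (Pt n)) (F G : Pt n → Pt n) : ℝ := ∫ x in Ω, inner ℝ (F x) (G x)

/-- `φ ∈ C_c^∞(Ω)`. -/
def IsTestFunction (Ω : Set (Pt n)) (φ : Pt n → ℝ) : Prop :=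
  ContDiff ℝ ∞ φ ∧ HasCompactSupport φ ∧ tsupport φ ⊆ Ω

/-- `g` is the weak gradient of `y` on `Ω`. -/
def HasWeakGradient (Ω : Set (Pt n)) (y : Pt n → ℝ) (g : Pt n → Pt n) : Prop :=
  ∀ φ : Pt n → ℝ, IsTestFunction Ω φ → ∀ e : Pt n,
    ∫ x in Ω, y x * fderiv ℝ φ x e = - ∫ x in Ω, inner ℝ (g x) e * φ x

/-- `y ∈ H¹(Ω)`, with weak gradient `g ∈ L²(Ω)ⁿ`. -/
structure IsH1 (Ω : Set (Pt n)) (y : Pt n → ℝ) (g : Pt n → Pt n) : Prop where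
  memL2 : MemL2 Ω y
  grad_memL2 : MemLp g 2 (volume.restrict Ω)
  weak : HasWeakGradient Ω y g

/-- `y ∈ H₀¹(Ω)`, with weak gradient `g`: the closure of `C_c^∞(Ω)` in the norm of `H¹(Ω)`. -/
structure IsH10 (Ω : Set (Pt n)) (y : Pt n → ℝ) (g : Pt n → Pt n) : Prop extends IsH1 Ω y g where
  approx : ∃ φ : ℕ → Pt n → ℝ, (∀ k, IsTestFunction Ω (φ k)) ∧
    Tendsto (fun k => eLpNorm (fun x => y x - φ k x) 2 (volume.restrict Ω)) atTop (𝓝 0) ∧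
    Tendsto (fun k => eLpNorm (fun x => g x - gradient (φ k) x) 2 (volume.restrict Ω))
      atTop (𝓝 0)

/-- `y ∈ H₀¹(Ω)` is the weak solution of `-Δ y = f` in `Ω`, `y = 0` on `∂Ω`; that is,
`y = S f`. -/
def IsWeakSolution (Ω : Set (Pt n)) (f y : Pt n → ℝ) : Prop :=
  ∃ dy : Pt n → Pt n, IsH10 Ω y dy ∧
    ∀ (z : Pt n → ℝ) (dz : Pt n → Pt n), IsH10 Ω z dz → vip Ω dy dz = ip Ω f z

/-- The Slater condition: some control `û ∈ L²(Ω)` has a state `ŷ = S û` (through its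
representative that is continuous on the closure of `Ω`) lying strictly between `a` and `b` on the
closure of `Ω`. -/
def Slater (Ω : Set (Pt n)) (a b : ℝ) : Prop :=
  ∃ û ŷ : Pt n → ℝ, MemL2 Ω û ∧ IsWeakSolution Ω û ŷ ∧ ContinuousOn ŷ (closure Ω) ∧
    ∀ x ∈ closure Ω, a < ŷ x ∧ ŷ x < b

/-- The cost `½ ‖y - y_d‖²_{L²(D)} + (α/2) ‖u‖²_{L²(D)}`. -/
def cost (D : Set (Pt n)) (yd : Pt n → ℝ) (α : ℝ) (y u : Pt n → ℝ) : ℝ :=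
  1 / 2 * (∫ x in D, (y x - yd x) ^ 2) + α / 2 * (∫ x in D, u x ^ 2)

/-- The mixed control-state constraint `a ≤ lam * u + y ≤ b` a.e. in `Ω`. -/
def MixedConstraint (Ω : Set (Pt n)) (a b lam : ℝ) (y u : Pt n → ℝ) : Prop :=
  ∀ᵐ x ∂(volume.restrict Ω), a ≤ lam * u x + y x ∧ lam * u x + y x ≤ b

/-! ### The regularized problem -/

/-- Admissible pairs of the regularized problem with parameter `lam`. -/
structure Feasible (Ω : Set (Pt n)) (a b lam : ℝ) (y u : Pt n → ℝ) : Prop where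
  control : MemL2 Ω u
  state : IsWeakSolution Ω u y
  bounds : MixedConstraint Ω a b lam y u

/-- `(y, u)` solves the regularized problem with parameter `lam`. -/
def IsSolution (Ω : Set (Pt n)) (yd : Pt n → ℝ) (a b α lam : ℝ) (y u : Pt n → ℝ) : Prop :=
  Feasible Ω a b lam y u ∧
    ∀ y' u', Feasible Ω a b lam y' u' → cost Ω yd α y u ≤ cost Ω yd α y' u'

/-- `μa, μb ∈ L²(Ω)` are Lagrange multipliers, with adjoint state `p`, at the solution `(y, u)` of
the regularized problem: the optimality system holds. -/
structure IsMultiplier (Ω : Set (Pt n)) (yd : Pt n → ℝ) (a b α lam : ℝ)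
    (y u p μa μb : Pt n → ℝ) : Prop where
  solution : IsSolution Ω yd a b α lam y u
  memL2_a : MemL2 Ω μa
  memL2_b : MemL2 Ω μb
  adjoint : IsWeakSolution Ω (fun x => y x - yd x - μa x + μb x) p
  gradient_eq : ∀ᵐ x ∂(volume.restrict Ω), α * u x + p x + lam * μb x - lam * μa x = 0
  compl_a : ip Ω μa (fun x => a - lam * u x - y x) = 0
  compl_b : ip Ω μb (fun x => lam * u x + y x - b) = 0
  nonneg_a : ∀ᵐ x ∂(volume.restrict Ω), 0 ≤ μa x
  nonneg_b : ∀ᵐ x ∂(volume.restrict Ω), 0 ≤ μb x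

/-! ### The discretized problem -/

/-- An admissible (face-to-face) partition of a polyhedral set `Ω̄_h ⊆ Ω̄` into finitely many closed
`n`-simplices, given with all faces of these simplices. -/
structure Mesh (Ω : Set (Pt n)) where
  complex : Geometry.SimplicialComplex ℝ (Pt n)
  finite : complex.faces.Finite
  pure : ∀ s ∈ complex.faces, ∃ t ∈ complex.faces, s ⊆ t ∧ t.card = n + 1
  subset_closure : complex.space ⊆ closure Ω

/-- `Ω_h`, the interior of the union of the simplices. -/
def Mesh.domain {Ω : Set (Pt n)} (T : Mesh Ω) : Set (Pt n) := interior T.complex.space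

theorem Mesh.finite_vertices {Ω : Set (Pt n)} (T : Mesh Ω) : T.complex.vertices.Finite := by
  have h := T.finite.preimage (f := fun x : Pt n => ({x} : Finset (Pt n)))
    (Finset.singleton_injective.injOn)
  exact h.subset fun x hx => hx

/-- The interior nodes `x_i` of the mesh, which carry the nodal basis of `Z_h`. -/
def Mesh.nodes {Ω : Set (Pt n)} (T : Mesh Ω) : Finset (Pt n) :=
  (T.finite_vertices.inter_of_left T.domain).toFinset

/-- The finite element space `Z_h`: functions continuous on the closure of `Ω`, affine on each
`n`-simplex of the mesh, and zero on `Ω̄ \ Ω_h`. -/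
structure MemZ {Ω : Set (Pt n)} (T : Mesh Ω) (z : Pt n → ℝ) : Prop where
  cont : ContinuousOn z (closure Ω)
  affine : ∀ s ∈ T.complex.faces, s.card = n + 1 →
    ∃ A : Pt n →ᵃ[ℝ] ℝ, ∀ x ∈ convexHull ℝ (s : Set (Pt n)), z x = A x
  zero : ∀ x ∈ closure Ω \ T.domain, z x = 0

/-- `(∇y, ∇z)` for piecewise affine functions, whose gradient exists almost everywhere. -/
def stiff (Ω : Set (Pt n)) (y z : Pt n → ℝ) : ℝ := vip Ω (gradient y) (gradient z)

/-- Admissible pairs of the discretized regularized problem. -/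
structure DFeasible {Ω : Set (Pt n)} (T : Mesh Ω) (a b lam : ℝ) (y u : Pt n → ℝ) : Prop where
  control : MemZ T u
  memZ : MemZ T y
  state : ∀ z, MemZ T z → stiff Ω y z = ip Ω u z
  bounds : MixedConstraint Ω a b lam y u

/-- `(y, u)` solves the discretized regularized problem. -/
def IsDSolution {Ω : Set (Pt n)} (T : Mesh Ω) (yd : Pt n → ℝ) (a b α lam : ℝ)
    (y u : Pt n → ℝ) : Prop :=
  DFeasible T a b lam y u ∧
    ∀ y' u', DFeasible T a b lam y' u' → cost T.domain yd α y u ≤ cost T.domain yd α y' u'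

/-- `μa, μb ∈ L²(Ω)` are Lagrange multipliers, with adjoint state `p ∈ Z_h`, at the solution
`(y, u)` of the discretized problem: the discrete optimality system holds, with the conditions on
the multipliers required almost everywhere in `Ω`. -/
structure IsDMultiplier {Ω : Set (Pt n)} (T : Mesh Ω) (yd : Pt n → ℝ) (a b α lam : ℝ)
    (y u p μa μb : Pt n → ℝ) : Prop where
  solution : IsDSolution T yd a b α lam y u
  memL2_a : MemL2 Ω μa
  memL2_b : MemL2 Ω μb
  adjoint_memZ : MemZ T p
  adjoint : ∀ z, MemZ T z → stiff Ω p z = ip Ω (fun x => y x - yd x - μa x + μb x) z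
  gradient_eq : ∀ᵐ x ∂(volume.restrict Ω), α * u x + p x + lam * μb x - lam * μa x = 0
  compl_a : ip Ω μa (fun x => a - lam * u x - y x) = 0
  compl_b : ip Ω μb (fun x => lam * u x + y x - b) = 0
  nonneg_a : ∀ᵐ x ∂(volume.restrict Ω), 0 ≤ μa x
  nonneg_b : ∀ᵐ x ∂(volume.restrict Ω), 0 ≤ μb x

/-- The duality `∑_i m_i z(x_i)` between nodal multipliers and functions. -/
def nodal {Ω : Set (Pt n)} (T : Mesh Ω) (m z : Pt n → ℝ) : ℝ := ∑ x ∈ T.nodes, m x * z x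

/-- The same for the multipliers of the discretized problem in its coefficient form, where the
constraint reads `a ≤ lam * u_i + y_i ≤ b` for every interior node, so that the multipliers are
vectors `(m x_i)_i` and the equations hold when tested with all functions in `Z_h`.
Such a vector `m ≥ 0` corresponds to the function `∑_i (m_i / ∫ φ_i) φ_i` with the nodal basis
`φ_i` (lumped mass matrix), and its `L¹` norm is `∑_i m_i`. -/
structure IsNodalMultiplier {Ω : Set (Pt n)} (T : Mesh Ω) (yd : Pt n → ℝ) (a b α lam : ℝ)
    (y u p ma mb : Pt n → ℝ) : Prop where
  solution : IsDSolution T yd a b α lam y u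
  adjoint_memZ : MemZ T p
  adjoint : ∀ z, MemZ T z →
    stiff Ω p z = ip Ω (fun x => y x - yd x) z - nodal T ma z + nodal T mb z
  gradient_eq : ∀ z, MemZ T z →
    α * ip Ω u z + ip Ω p z + lam * nodal T mb z - lam * nodal T ma z = 0
  compl_a : nodal T ma (fun x => a - lam * u x - y x) = 0
  compl_b : nodal T mb (fun x => lam * u x + y x - b) = 0
  nonneg_a : ∀ x ∈ T.nodes, 0 ≤ ma x
  nonneg_b : ∀ x ∈ T.nodes, 0 ≤ mb x

/-- The norm of `L¹(Ω)`. -/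
def L1norm (Ω : Set (Pt n)) (f : Pt n → ℝ) : ENNReal := eLpNorm f 1 (volume.restrict Ω)

end Lavrentiev

end

namespace Lavrentiev

variable {n : ℕ}

/-! ### Calculus and `L²` preliminaries. -/

/-- Squaring removes the kink of the positive part, so truncations of test functions stay
differentiable and can be integrated by parts classically. -/
lemma hasDerivAt_posPart_sq (s : ℝ) : HasDerivAt (fun t : ℝ => max 0 t ^ 2) (2 * max 0 s) s := by
  rcases lt_trichotomy s 0 with h | rfl | h
  · have : (fun t : ℝ => max 0 t ^ 2) =ᶠ[𝓝 s] fun _ => 0 := by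
      filter_upwards [gt_mem_nhds h] with t ht
      simp [max_eq_left ht.le]
    rw [max_eq_left h.le, mul_zero]
    exact (hasDerivAt_const s (0 : ℝ)).congr_of_eventuallyEq this
  · rw [max_self, mul_zero, hasDerivAt_iff_isLittleO_nhds_zero]
    simp only [zero_add, max_self, smul_zero, sub_zero, ne_eq, OfNat.ofNat_ne_zero,
      not_false_eq_true, zero_pow]
    refine Asymptotics.IsBigO.trans_isLittleO (g := fun h : ℝ => h ^ 2) ?_ ?_
    · refine Asymptotics.IsBigO.of_bound 1 (Eventually.of_forall fun t => ?_)
      rw [one_mul, norm_pow, norm_pow, Real.norm_eq_abs, Real.norm_eq_abs]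
      refine pow_le_pow_left₀ (abs_nonneg _) ?_ 2
      rw [abs_of_nonneg (le_max_left _ _)]
      exact max_le (abs_nonneg _) (le_abs_self _)
    · exact Asymptotics.isLittleO_pow_id one_lt_two
  · have : (fun t : ℝ => max 0 t ^ 2) =ᶠ[𝓝 s] fun t => t ^ 2 := by
      filter_upwards [lt_mem_nhds h] with t ht
      simp [max_eq_right ht.le]
    rw [max_eq_right h.le]
    simpa using (hasDerivAt_pow 2 s).congr_of_eventuallyEq this

lemma toReal_eLpNorm_two_sq {X E : Type*} [MeasurableSpace X] [NormedAddCommGroup E]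
    {μ : Measure X} {f : X → E} (hf : MemLp f 2 μ) :
    (eLpNorm f 2 μ).toReal ^ 2 = ∫ x, ‖f x‖ ^ 2 ∂μ := by
  have h0 : 0 ≤ ∫ x, ‖f x‖ ^ 2 ∂μ := integral_nonneg fun x => by positivity
  rw [hf.eLpNorm_eq_integral_rpow_norm two_ne_zero ENNReal.ofNat_ne_top,
    ENNReal.toReal_ofReal (by positivity), ← Real.rpow_mul_natCast (by positivity)]
  simp

/-- The Cauchy-Schwarz inequality for the norms of two square integrable functions. -/
lemma integral_norm_mul_norm_le {X E F : Type*} [MeasurableSpace X] [NormedAddCommGroup E]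
    [NormedAddCommGroup F] {μ : Measure X} {f : X → E} {g : X → F} (hf : MemLp f 2 μ)
    (hg : MemLp g 2 μ) :
    ∫ x, ‖f x‖ * ‖g x‖ ∂μ ≤ (eLpNorm f 2 μ).toReal * (eLpNorm g 2 μ).toReal := by
  have h := integral_mul_le_Lp_mul_Lq_of_nonneg Real.HolderConjugate.two_two
    (Eventually.of_forall fun x => norm_nonneg (f x))
    (Eventually.of_forall fun x => norm_nonneg (g x))
    (by simpa using hf.norm) (by simpa using hg.norm)
  simp only [Real.rpow_two] at h
  rw [← toReal_eLpNorm_two_sq hf, ← toReal_eLpNorm_two_sq hg, ← Real.sqrt_eq_rpow,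
    ← Real.sqrt_eq_rpow, Real.sqrt_sq ENNReal.toReal_nonneg,
    Real.sqrt_sq ENNReal.toReal_nonneg] at h
  exact h

/-! ### Positive lower bounds are incompatible with `H₀¹`. -/

/-- Integration by parts of a truncation of a test function against a coordinate. -/
lemma integral_truncation {Ω : Set (Pt n)} {φ : Pt n → ℝ}
    (hφ : IsTestFunction Ω φ) {ε : ℝ} (hε : 0 < ε) (i : Fin n) :
    ∫ x in Ω, (ε ^ 2 - max 0 (ε - φ x) ^ 2) =
      - ∫ x in Ω, x i * (2 * max 0 (ε - φ x) * fderiv ℝ φ x (EuclideanSpace.single i 1)) := by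
  obtain ⟨hsm, hcs, hsub⟩ := hφ
  set e : Pt n := EuclideanSpace.single i 1 with he
  -- The offset `ε ^ 2` makes `ψ` vanish wherever `φ` does, so `ψ` inherits compact support.
  set ψ : Pt n → ℝ := fun x => ε ^ 2 - max 0 (ε - φ x) ^ 2 with hψ
  set dψ : Pt n → ℝ := fun x => 2 * max 0 (ε - φ x) * fderiv ℝ φ x e with hdψ
  have hφ0 : ∀ x ∉ Ω, φ x = 0 := fun x hx => image_eq_zero_of_notMem_tsupport fun h => hx (hsub h)
  have hdφ0 : ∀ x ∉ Ω, fderiv ℝ φ x = 0 := fun x hx =>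
    image_eq_zero_of_notMem_tsupport fun h => hx (hsub (tsupport_fderiv_subset ℝ h))
  have hψ0 : ∀ x, φ x = 0 → ψ x = 0 := fun x hx => by simp [hψ, hx, max_eq_right hε.le]
  have hφd : ∀ x, HasFDerivAt φ (fderiv ℝ φ x) x := fun x =>
    (hsm.differentiable (by simp) x).hasFDerivAt
  have hφc : Continuous φ := hsm.continuous
  have hdφc : Continuous fun x => fderiv ℝ φ x e :=
    (hsm.continuous_fderiv (by simp)).clm_apply continuous_const
  have hψd : ∀ x, HasLineDerivAt ℝ ψ (dψ x) x e := by
    intro x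
    have h := ((hasDerivAt_posPart_sq (ε - φ x)).comp_hasFDerivAt x
      ((hφd x).const_sub ε)).const_sub (ε ^ 2)
    have h' : (-((2 * max 0 (ε - φ x)) • -fderiv ℝ φ x)) e = dψ x := by simp [hdψ]
    exact h' ▸ h.hasLineDerivAt e
  have hcd : ∀ x : Pt n, HasLineDerivAt ℝ (fun x : Pt n => x i) 1 x e := by
    intro x
    have h := ((EuclideanSpace.proj i : Pt n →L[ℝ] ℝ).hasFDerivAt (x := x)).hasLineDerivAt e
    simpa [he] using h
  have hψcs : HasCompactSupport ψ := hcs.mono fun x hx h => hx (hψ0 x h)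
  have hdcs : HasCompactSupport dψ := by
    refine (hcs.fderiv ℝ).mono fun x hx h => hx ?_
    simp [hdψ, h]
  have hψc : Continuous ψ := by fun_prop
  have hdc : Continuous dψ := by fun_prop
  have hcc : Continuous fun x : Pt n => x i := by fun_prop
  -- The coordinate `x i` has derivative `1` along `e`, which leaves the integral of `ψ` itself on
  -- one side.
  have key := integral_bilinear_hasLineDerivAt_right_eq_neg_left_of_integrable
    (μ := (volume : Measure (Pt n))) (f := fun x : Pt n => x i) (f' := fun _ => 1) (g := ψ)
    (g' := dψ) (v := e) (B := ContinuousLinearMap.mul ℝ ℝ)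
    ((continuous_const.mul hψc).integrable_of_hasCompactSupport hψcs.mul_left)
    ((hcc.mul hdc).integrable_of_hasCompactSupport hdcs.mul_left)
    ((hcc.mul hψc).integrable_of_hasCompactSupport hψcs.mul_left) (fun x _ => hcd x) (fun x _ => hψd x)
  simp only [ContinuousLinearMap.mul_apply', one_mul] at key
  rw [setIntegral_eq_integral_of_forall_compl_eq_zero fun x hx => hψ0 x (hφ0 x hx),
    setIntegral_eq_integral_of_forall_compl_eq_zero fun x hx => by simp [hdφ0 x hx]]
  linarith

/-- A function in `H₀¹(Ω)` cannot be bounded below by a positive constant. -/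
lemma IsH10.not_pos_le (hn : 0 < n) {Ω : Set (Pt n)} (hΩo : IsOpen Ω)
    (hΩb : Bornology.IsBounded Ω) (hΩne : Ω.Nonempty) {y : Pt n → ℝ} {g : Pt n → Pt n}
    (hy : IsH10 Ω y g) {ε : ℝ} (hε : 0 < ε) (hle : ∀ x ∈ Ω, ε ≤ y x) : False := by
  obtain ⟨φ, hφ, hφy, hφg⟩ := hy.approx
  set ν := volume.restrict Ω with hν
  have : IsFiniteMeasure ν := ⟨by simpa [hν] using hΩb.measure_lt_top⟩
  obtain ⟨R, hR⟩ := hΩb.exists_norm_le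
  set i : Fin n := ⟨0, hn⟩
  have hR0 : 0 ≤ R := (norm_nonneg _).trans (hR _ hΩne.some_mem)
  have hle' : ∀ᵐ x ∂ν, x ∈ Ω ∧ ε ≤ y x := by
    filter_upwards [ae_restrict_mem hΩo.measurableSet] with x hx using ⟨hx, hle x hx⟩
  have hφm : ∀ k, MemLp (φ k) 2 ν := fun k =>
    ((hφ k).1.continuous.memLp_of_hasCompactSupport (hφ k).2.1).restrict Ω
  have hgc : ∀ k, Continuous (gradient (φ k)) := fun k => by
    unfold gradient
    exact (InnerProductSpace.toDual ℝ (Pt n)).symm.continuous.comp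
      ((hφ k).1.continuous_fderiv (by simp))
  have hgm : ∀ k, MemLp (gradient (φ k)) 2 ν := fun k => by
    refine ((hgc k).memLp_of_hasCompactSupport ?_).restrict Ω
    refine ((hφ k).2.1.fderiv ℝ).mono fun x hx h => hx ?_
    simp [gradient, h]
  set A : ℕ → ℝ := fun k => (eLpNorm (fun x => y x - φ k x) 2 ν).toReal with hA
  set B : ℕ → ℝ := fun k => (eLpNorm (fun x => g x - gradient (φ k) x) 2 ν).toReal with hB
  set G : ℝ := (eLpNorm g 2 ν).toReal with hG
  have hA0 : Tendsto A atTop (𝓝 0) := by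
    exact (ENNReal.tendsto_toReal ENNReal.zero_ne_top).comp hφy
  have hB0 : Tendsto B atTop (𝓝 0) := by
    exact (ENNReal.tendsto_toReal ENNReal.zero_ne_top).comp hφg
  -- Where `y ≥ ε`, the positive part of `ε - φ k` is at most `|y - φ k|`. This bounds the truncated
  -- integral from below by `ε² |Ω| - A k ^ 2`; after integration by parts, Cauchy-Schwarz bounds it
  -- from above. As `A k → 0` and `G + B k` stays bounded, the limit gives `ε² |Ω| ≤ 0`.
  have bound : ∀ k, ε ^ 2 * ν.real Set.univ ≤ A k ^ 2 + 2 * R * (A k * (G + B k)) := by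
    intro k
    have hd : MemLp (fun x => y x - φ k x) 2 ν := hy.memL2.sub (hφm k)
    have hdg : MemLp (fun x => g x - gradient (φ k) x) 2 ν := hy.grad_memL2.sub (hgm k)
    have hAk : A k ^ 2 = ∫ x, (y x - φ k x) ^ 2 ∂ν := by
      simpa using toReal_eLpNorm_two_sq hd
    have hgrad : (eLpNorm (gradient (φ k)) 2 ν).toReal ≤ G + B k := by
      have h1 : gradient (φ k) = g - fun x => g x - gradient (φ k) x := by
        ext1 x; simp
      have h2 := eLpNorm_sub_le (p := 2) hy.grad_memL2.1 hdg.1 (by norm_num)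
      rw [← h1] at h2
      refine (ENNReal.toReal_mono (ENNReal.add_ne_top.2 ⟨hy.grad_memL2.2.ne, hdg.2.ne⟩) h2).trans ?_
      rw [ENNReal.toReal_add hy.grad_memL2.2.ne hdg.2.ne]
    have hCS : ∫ x, |y x - φ k x| * ‖gradient (φ k) x‖ ∂ν ≤ A k * (G + B k) :=
      (integral_norm_mul_norm_le hd (hgm k)).trans
        (mul_le_mul_of_nonneg_left hgrad ENNReal.toReal_nonneg)
    have hint : Integrable (fun x => |y x - φ k x| * ‖gradient (φ k) x‖) ν :=
      MemLp.integrable_mul hd.norm (hgm k).norm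
    have htr := integral_truncation (hφ k) hε i
    have h1 : ε ^ 2 * ν.real Set.univ - A k ^ 2 ≤
        ∫ x in Ω, (ε ^ 2 - max 0 (ε - φ k x) ^ 2) := by
      have : ε ^ 2 * ν.real Set.univ - A k ^ 2 = ∫ x, (ε ^ 2 - (y x - φ k x) ^ 2) ∂ν := by
        rw [integral_sub (integrable_const _) hd.integrable_sq, hAk, integral_const, smul_eq_mul,
          mul_comm]
      rw [this]
      refine integral_mono_ae ((integrable_const _).sub hd.integrable_sq) ?_ ?_
      · have hm : MemLp (fun x => ε - φ k x) 2 ν := (memLp_const ε).sub (hφm k)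
        have hm' : MemLp (fun x => max 0 (ε - φ k x)) 2 ν := by
          refine hm.mono (by
            exact (continuous_const.max
              (continuous_const.sub (hφ k).1.continuous)).aestronglyMeasurable) ?_
          refine Eventually.of_forall fun x => ?_
          rw [Real.norm_eq_abs, Real.norm_eq_abs, abs_of_nonneg (le_max_left _ _)]
          exact max_le (abs_nonneg _) (le_abs_self _)
        exact (integrable_const _).sub hm'.integrable_sq
      · filter_upwards [hle'] with x hx
        have : max 0 (ε - φ k x) ≤ |y x - φ k x| :=
          max_le (abs_nonneg _) ((sub_le_sub_right hx.2 _).trans (le_abs_self _))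
        have := pow_le_pow_left₀ (le_max_left _ _) this 2
        rw [sq_abs] at this
        linarith
    have h2 : - ∫ x in Ω, x i * (2 * max 0 (ε - φ k x) *
        fderiv ℝ (φ k) x (EuclideanSpace.single i 1)) ≤
        2 * R * ∫ x, |y x - φ k x| * ‖gradient (φ k) x‖ ∂ν := by
      refine (neg_le_abs _).trans ?_
      rw [← integral_const_mul, ← Real.norm_eq_abs]
      refine norm_integral_le_of_norm_le (hint.const_mul _) ?_
      filter_upwards [hle'] with x hx
      have h3 : max 0 (ε - φ k x) ≤ |y x - φ k x| :=
        max_le (abs_nonneg _) ((sub_le_sub_right hx.2 _).trans (le_abs_self _))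
      have h4 : |x i| ≤ R := (PiLp.norm_apply_le x i).trans (hR x hx.1)
      have h5 : |fderiv ℝ (φ k) x (EuclideanSpace.single i 1)| ≤ ‖gradient (φ k) x‖ := by
        have := (fderiv ℝ (φ k) x).le_opNorm (EuclideanSpace.single i 1)
        simpa [gradient] using this
      rw [Real.norm_eq_abs, abs_mul, abs_mul, abs_mul, abs_two,
        abs_of_nonneg (le_max_left 0 (ε - φ k x))]
      calc |x i| * (2 * max 0 (ε - φ k x) * |fderiv ℝ (φ k) x (EuclideanSpace.single i 1)|)
          ≤ R * (2 * |y x - φ k x| * ‖gradient (φ k) x‖) := by gcongr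
        _ = _ := by ring
    have h3 := mul_le_mul_of_nonneg_left hCS (mul_nonneg zero_le_two hR0)
    linarith
  have hlim : Tendsto (fun k => A k ^ 2 + 2 * R * (A k * (G + B k))) atTop (𝓝 0) := by
    have := (hA0.pow 2).add ((hA0.mul (hB0.const_add G)).const_mul (2 * R))
    simpa using this
  have h0 := ge_of_tendsto' hlim bound
  have hpos : 0 < ν.real Set.univ := by
    rw [measureReal_def]
    refine ENNReal.toReal_pos ?_ (measure_ne_top _ _)
    simpa [hν] using (hΩo.measure_pos volume hΩne).ne'
  have := mul_pos (pow_pos hε 2) hpos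
  linarith

/-! ### Signs of the bounds `a` and `b`. -/

lemma HasWeakGradient.neg {Ω : Set (Pt n)} {y : Pt n → ℝ} {g : Pt n → Pt n}
    (h : HasWeakGradient Ω y g) : HasWeakGradient Ω (-y) (-g) := by
  intro φ hφ e
  simpa [integral_neg] using congrArg Neg.neg (h φ hφ e)

lemma IsH10.neg {Ω : Set (Pt n)} {y : Pt n → ℝ} {g : Pt n → Pt n} (h : IsH10 Ω y g) :
    IsH10 Ω (-y) (-g) := by
  obtain ⟨φ, hφ, hφy, hφg⟩ := h.approx
  refine ⟨⟨MemLp.neg h.memL2, h.grad_memL2.neg, h.weak.neg⟩, fun k => -φ k, fun k => ?_, ?_, ?_⟩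
  · refine ⟨(hφ k).1.neg, (hφ k).2.1.neg, ?_⟩
    have : tsupport (-φ k) = tsupport (φ k) := by simp [tsupport]
    rw [this]
    exact (hφ k).2.2
  · refine hφy.congr fun k => ?_
    rw [← eLpNorm_neg]
    congr 1
    ext x
    simp; ring
  · refine hφg.congr fun k => ?_
    rw [← eLpNorm_neg]
    congr 1
    ext1 x
    have : gradient (-φ k) x = -gradient (φ k) x := by simp [gradient, fderiv_neg]
    simp [this]; abel

/-- Homogeneous boundary values force the bounds of a Slater point to have opposite signs. -/
lemma Slater.neg_and_pos (hn : 0 < n) {Ω : Set (Pt n)} (hΩo : IsOpen Ω)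
    (hΩb : Bornology.IsBounded Ω) (hΩne : Ω.Nonempty) {a b : ℝ} (hS : Slater Ω a b) :
    a < 0 ∧ 0 < b := by
  obtain ⟨u, y, -, ⟨g, hy, -⟩, hc, hab⟩ := hS
  have hK : IsCompact (closure Ω) := hΩb.isCompact_closure
  constructor
  · by_contra! ha
    obtain ⟨x₀, hx₀, hmin⟩ := hK.exists_isMinOn hΩne.closure hc
    exact hy.not_pos_le hn hΩo hΩb hΩne (ha.trans_lt (hab x₀ hx₀).1)
      fun x hx => hmin (subset_closure hx)
  · by_contra! hb
    obtain ⟨x₀, hx₀, hmax⟩ := hK.exists_isMaxOn hΩne.closure hc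
    exact hy.neg.not_pos_le hn hΩo hΩb hΩne (neg_pos.2 ((hab x₀ hx₀).2.trans_le hb))
      fun x hx => neg_le_neg (hmax (subset_closure hx))

/-! ### Testing the optimality systems. -/

lemma vip_comm (Ω : Set (Pt n)) (F G : Pt n → Pt n) : vip Ω F G = vip Ω G F := by
  simp only [vip, real_inner_comm]

lemma MemZ.memL2 {Ω : Set (Pt n)} (hΩo : IsOpen Ω) (hΩb : Bornology.IsBounded Ω) {T : Mesh Ω}
    {z : Pt n → ℝ} (hz : MemZ T z) : MemL2 Ω z := by
  have : IsFiniteMeasure (volume.restrict Ω) := ⟨by simpa using hΩb.measure_lt_top⟩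
  obtain ⟨M, hM⟩ := hΩb.isCompact_closure.exists_bound_of_continuousOn hz.cont
  refine MemLp.of_bound ((hz.cont.mono subset_closure).aestronglyMeasurable hΩo.measurableSet) M ?_
  filter_upwards [ae_restrict_mem hΩo.measurableSet] with x hx using hM x (subset_closure hx)

/-- The optimality system, tested with the state, the adjoint state and the control. -/
lemma weighted_integral_multiplier_le {Ω : Set (Pt n)} (hΩb : Bornology.IsBounded Ω)
    {yd y u p μa μb : Pt n → ℝ} {a b α lam : ℝ} (hα : 0 < α) (hyd : MemL2 Ω yd)
    (hy : MemL2 Ω y) (hu : MemL2 Ω u) (hp : MemL2 Ω p) (ha : MemL2 Ω μa) (hb : MemL2 Ω μb)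
    (hst : ip Ω (fun x => y x - yd x - μa x + μb x) y = ip Ω u p)
    (hgr : ∀ᵐ x ∂(volume.restrict Ω), α * u x + p x + lam * μb x - lam * μa x = 0)
    (hca : ip Ω μa (fun x => a - lam * u x - y x) = 0)
    (hcb : ip Ω μb (fun x => lam * u x + y x - b) = 0) :
    b * (∫ x in Ω, μb x) - a * (∫ x in Ω, μa x) ≤ 1 / 4 * ∫ x in Ω, yd x ^ 2 := by
  have : IsFiniteMeasure (volume.restrict Ω) := ⟨by simpa using hΩb.measure_lt_top⟩
  unfold ip at *
  unfold MemL2 at *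
  set ν := volume.restrict Ω
  have i1 : Integrable (fun x => (y x - yd x - μa x + μb x) * y x) ν :=
    (((hy.sub hyd).sub ha).add hb).integrable_mul hy
  have i2 : Integrable (fun x => u x * p x) ν := hu.integrable_mul hp
  have i3 : Integrable (fun x => μa x * (a - lam * u x - y x)) ν :=
    ha.integrable_mul (((memLp_const a).sub (hu.const_mul lam)).sub hy)
  have i4 : Integrable (fun x => μb x * (lam * u x + y x - b)) ν :=
    hb.integrable_mul (((hu.const_mul lam).add hy).sub (memLp_const b))
  have j1 := (hb.integrable one_le_two).const_mul b
  have j2 := (ha.integrable one_le_two).const_mul a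
  have j3 := hyd.integrable_sq.const_mul (1 / 4)
  -- The right integrand collects the tested equations and complementarity terms, so its integral is
  -- `0`. Once `p` is eliminated, it exceeds the left one by `(y - yd / 2)² + α u²`.
  have h := integral_mono_ae (μ := ν) ((j1.sub j2).sub j3) (((i1.sub i2).sub i3).sub i4) (by
    filter_upwards [hgr] with x hx
    have hp' : p x = -(α * u x) - lam * μb x + lam * μa x := by linarith
    simp only [Pi.sub_apply]
    rw [hp']
    nlinarith [sq_nonneg (y x - yd x / 2), mul_nonneg hα.le (sq_nonneg (u x))])
  rw [integral_sub' (j1.sub j2) j3, integral_sub' j1 j2, integral_sub' ((i1.sub i2).sub i3) i4,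
    integral_sub' (i1.sub i2) i3, integral_sub' i1 i2, integral_const_mul, integral_const_mul,
    integral_const_mul, hst, hca, hcb] at h
  linarith

/-- Both weights `-a` and `b` are positive, so neither mass can compensate the other. -/
lemma le_div_of_weighted_le {a b A B I : ℝ} (ha : a < 0) (hb : 0 < b) (hA : 0 ≤ A) (hB : 0 ≤ B)
    (h : b * B - a * A ≤ I) : A ≤ I / min (-a) b ∧ B ≤ I / min (-a) b := by
  have hδ : 0 < min (-a) b := lt_min (neg_pos.2 ha) hb
  have h1 := mul_le_mul_of_nonneg_right (min_le_left (-a) b) hA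
  have h2 := mul_le_mul_of_nonneg_right (min_le_right (-a) b) hB
  have h3 := mul_nonneg hδ.le hA
  have h4 := mul_nonneg hδ.le hB
  rw [le_div_iff₀ hδ, le_div_iff₀ hδ]
  constructor <;> linarith

lemma L1norm_eq_ofReal_integral {Ω : Set (Pt n)} (hΩb : Bornology.IsBounded Ω) {f : Pt n → ℝ}
    (hf : MemL2 Ω f) (h0 : ∀ᵐ x ∂(volume.restrict Ω), 0 ≤ f x) :
    L1norm Ω f = ENNReal.ofReal (∫ x in Ω, f x) := by
  have : IsFiniteMeasure (volume.restrict Ω) := ⟨by simpa using hΩb.measure_lt_top⟩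
  rw [ofReal_integral_eq_lintegral_ofReal (hf.integrable one_le_two) h0, L1norm,
    eLpNorm_one_eq_lintegral_enorm]
  refine lintegral_congr_ae ?_
  filter_upwards [h0] with x hx
  exact Real.enorm_of_nonneg hx

lemma L1norm_multipliers_le {Ω : Set (Pt n)} (hΩb : Bornology.IsBounded Ω)
    {μa μb : Pt n → ℝ} {a b I : ℝ} (ha : a < 0) (hb : 0 < b) (hμa : MemL2 Ω μa)
    (hμb : MemL2 Ω μb) (ha0 : ∀ᵐ x ∂(volume.restrict Ω), 0 ≤ μa x)
    (hb0 : ∀ᵐ x ∂(volume.restrict Ω), 0 ≤ μb x)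
    (h : b * (∫ x in Ω, μb x) - a * (∫ x in Ω, μa x) ≤ I) :
    L1norm Ω μa ≤ ENNReal.ofReal (I / min (-a) b) ∧
      L1norm Ω μb ≤ ENNReal.ofReal (I / min (-a) b) := by
  rw [L1norm_eq_ofReal_integral hΩb hμa ha0, L1norm_eq_ofReal_integral hΩb hμb hb0]
  have := le_div_of_weighted_le ha hb (integral_nonneg_of_ae ha0) (integral_nonneg_of_ae hb0) h
  exact this.imp ENNReal.ofReal_le_ofReal ENNReal.ofReal_le_ofReal

lemma IsMultiplier.weighted_integral_le {Ω : Set (Pt n)} (hΩb : Bornology.IsBounded Ω)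
    {yd y u p μa μb : Pt n → ℝ} {a b α lam : ℝ} (hα : 0 < α) (hyd : MemL2 Ω yd)
    (h : IsMultiplier Ω yd a b α lam y u p μa μb) :
    b * (∫ x in Ω, μb x) - a * (∫ x in Ω, μa x) ≤ 1 / 4 * ∫ x in Ω, yd x ^ 2 := by
  obtain ⟨dy, hy, hyz⟩ := h.solution.1.state
  obtain ⟨dp, hp, hpz⟩ := h.adjoint
  refine weighted_integral_multiplier_le hΩb hα hyd hy.memL2 h.solution.1.control hp.memL2
    h.memL2_a h.memL2_b ?_ h.gradient_eq h.compl_a h.compl_b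
  rw [← hpz y dy hy, ← hyz p dp hp, vip_comm]

lemma IsDMultiplier.weighted_integral_le {Ω : Set (Pt n)} (hΩo : IsOpen Ω)
    (hΩb : Bornology.IsBounded Ω) {T : Mesh Ω}
    {yd y u p μa μb : Pt n → ℝ} {a b α lam : ℝ} (hα : 0 < α) (hyd : MemL2 Ω yd)
    (h : IsDMultiplier T yd a b α lam y u p μa μb) :
    b * (∫ x in Ω, μb x) - a * (∫ x in Ω, μa x) ≤ 1 / 4 * ∫ x in Ω, yd x ^ 2 := by
  have hf := h.solution.1
  refine weighted_integral_multiplier_le hΩb hα hyd (hf.memZ.memL2 hΩo hΩb)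
    (hf.control.memL2 hΩo hΩb) (h.adjoint_memZ.memL2 hΩo hΩb)
    h.memL2_a h.memL2_b ?_ h.gradient_eq h.compl_a h.compl_b
  rw [← h.adjoint y hf.memZ, ← hf.state p h.adjoint_memZ, stiff, stiff, vip_comm]

lemma IsNodalMultiplier.weighted_sum_le {Ω : Set (Pt n)} (hΩo : IsOpen Ω)
    (hΩb : Bornology.IsBounded Ω) {T : Mesh Ω}
    {yd y u p ma mb : Pt n → ℝ} {a b α lam : ℝ} (hα : 0 < α) (hyd : MemL2 Ω yd)
    (h : IsNodalMultiplier T yd a b α lam y u p ma mb) :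
    b * (∑ x ∈ T.nodes, mb x) - a * (∑ x ∈ T.nodes, ma x) ≤ 1 / 4 * ∫ x in Ω, yd x ^ 2 := by
  have hf := h.solution.1
  have hyL := hf.memZ.memL2 hΩo hΩb
  have hst : ip Ω (fun x => y x - yd x) y - nodal T ma y + nodal T mb y = ip Ω u p := by
    rw [← h.adjoint y hf.memZ, ← hf.state p h.adjoint_memZ, stiff, stiff, vip_comm]
  -- The gradient equation holds only against `Z_h` here, and the control is itself an admissible
  -- test function.
  have hgr := h.gradient_eq u hf.control
  have hpu : ip Ω p u = ip Ω u p := by simp only [ip, mul_comm]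
  have huu : 0 ≤ ip Ω u u := integral_nonneg fun x => mul_self_nonneg _
  have hca : a * (∑ x ∈ T.nodes, ma x) - lam * nodal T ma u - nodal T ma y = 0 := by
    rw [← h.compl_a]
    simp only [nodal, Finset.mul_sum, ← Finset.sum_sub_distrib]
    exact Finset.sum_congr rfl fun x _ => by ring
  have hcb : lam * nodal T mb u + nodal T mb y - b * (∑ x ∈ T.nodes, mb x) = 0 := by
    rw [← h.compl_b]
    simp only [nodal, Finset.mul_sum, ← Finset.sum_sub_distrib, ← Finset.sum_add_distrib]
    exact Finset.sum_congr rfl fun x _ => by ring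
  have hyy : - ip Ω (fun x => y x - yd x) y ≤ 1 / 4 * ∫ x in Ω, yd x ^ 2 := by
    rw [ip, ← integral_neg, ← integral_const_mul]
    refine integral_mono ((MemLp.integrable_mul (MemLp.sub hyL hyd) hyL).neg)
      ((MemLp.integrable_sq hyd).const_mul _) fun x => ?_
    simp only
    nlinarith [sq_nonneg (y x - yd x / 2)]
  linarith [mul_nonneg hα.le huu]

end Lavrentiev

theorem lemma3p5 (n : ℕ) (hn : n = 2 ∨ n = 3)
    (Ω : Set (Lavrentiev.Pt n)) (hΩo : IsOpen Ω) (hΩc : Convex ℝ Ω)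
    (hΩb : Bornology.IsBounded Ω) (hΩne : Ω.Nonempty)
    (yd : Lavrentiev.Pt n → ℝ) (hyd : Lavrentiev.MemL2 Ω yd)
    (a b α : ℝ) (hα : 0 < α) (hS : Lavrentiev.Slater Ω a b) :
    ∃ C : ℝ,
      (∀ lam : ℝ, 0 < lam → ∀ y u p μa μb : Lavrentiev.Pt n → ℝ,
        Lavrentiev.IsMultiplier Ω yd a b α lam y u p μa μb →
          Lavrentiev.L1norm Ω μa ≤ ENNReal.ofReal C ∧
          Lavrentiev.L1norm Ω μb ≤ ENNReal.ofReal C) ∧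
      (∀ (T : Lavrentiev.Mesh Ω) (lam : ℝ), 0 < lam →
        ∀ y u p μa μb : Lavrentiev.Pt n → ℝ,
        Lavrentiev.IsDMultiplier T yd a b α lam y u p μa μb →
          Lavrentiev.L1norm Ω μa ≤ ENNReal.ofReal C ∧
          Lavrentiev.L1norm Ω μb ≤ ENNReal.ofReal C) ∧
      (∀ (T : Lavrentiev.Mesh Ω) (lam : ℝ), 0 < lam →
        ∀ y u p ma mb : Lavrentiev.Pt n → ℝ,
        Lavrentiev.IsNodalMultiplier T yd a b α lam y u p ma mb →
          ∑ x ∈ T.nodes, ma x ≤ C ∧ ∑ x ∈ T.nodes, mb x ≤ C) := by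
  obtain ⟨ha, hb⟩ := hS.neg_and_pos (by omega) hΩo hΩb hΩne
  -- One constant serves all three claims: the bound `‖yd‖² / 4` divided by the smaller weight.
  refine ⟨1 / 4 * (∫ x in Ω, yd x ^ 2) / min (-a) b, ?_, ?_, ?_⟩
  · intro lam _ y u p μa μb h
    exact Lavrentiev.L1norm_multipliers_le hΩb ha hb h.memL2_a h.memL2_b h.nonneg_a h.nonneg_b
      (h.weighted_integral_le hΩb hα hyd)
  · intro T lam _ y u p μa μb h
    exact Lavrentiev.L1norm_multipliers_le hΩb ha hb h.memL2_a h.memL2_b h.nonneg_a h.nonneg_b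
      (h.weighted_integral_le hΩo hΩb hα hyd)
  · intro T lam _ y u p ma mb h
    exact Lavrentiev.le_div_of_weighted_le ha hb (Finset.sum_nonneg h.nonneg_a)
      (Finset.sum_nonneg h.nonneg_b) (h.weighted_sum_le hΩo hΩb hα hyd)
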